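/- **Setting.** Let $n\ge 2$ and let $M$ be an MDP with deterministic dynamics, initial state $s_0$ and $n$ collectible rewards: the reward of $M$ is $\sum_{i=1}^n R_i$, where $R_i$ equals $1$ at one state $s_i$ and $0$ elsewhere, and each reward can be collected only once. Let $d_{i,j}$ ($0\le i\le n$, $1\le j\le n$) be the length (number of steps) of a shortest path from $s_i$ to $s_j$. Assume that the associated graph is undirected: every $s_j$ can be reached from $s_0$ and from every $s_i$, and $d_{i,j}=d_{j,i}$ for $1\le i,j\le n$. Let $0<\gamma<1$ be the discount factor. A policy makes a walk on the nodes $s_0,s_1,\dots,s_n$ starting at $s_0$, in which moving from $s_i$ to $s_j$ takes time $d_{i,j}$; its return is $\sum_j\gamma^{t_j}$, where $t_j$ is the time of the first visit of the walk to $s_j$ (rewards $j$ that the walk does not visit contribute $0$). Let $$\mathrm{OPT}=\max_{\pi\in \mathrm{perm}\{1,\dots,n\}}\ \sum_{j=1}^{n}\gamma^{\,d_{0,\pi_1}+d_{\pi_1,\pi_2}+\dots+d_{\pi_{j-1},\pi_j}} .$$ **Policy.** NN repeatedly goes from the current node to the nearest reward not yet collected. NN-RDFS, with probability $1/2$, runs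 NN from $s_0$. With probability $1/2$ it goes first to a uniformly random reward $s$, draws independently $i$ uniformly from $\{1,\dots,\lfloor\log_2 n\rfloor\}$, sets $\theta=x/\sqrt{n/2^i}$ with $x=\log_{1/\gamma}2$, and runs a depth first search from $s$ on the edges shorter than $\theta$: from the current reward it goes to the nearest not yet visited reward at distance less than $\theta$ if there is one, and otherwise walks back to the reward from which the current one was discovered, until it is back at $s$ with no such reward left. Then it continues with NN until all rewards are collected. Ties among nearest rewards are broken by an arbitrary rule, which may depend on the walk so far. Let $\text{NN-RDFS}$ denote the expected return. **Theorem (NN-RDFS Performance).** 1. For every $\alpha>0$ there is a constant $c=c(\alpha)>0$ such that for all $n\ge 2$, all $M$, all $\gamma\in(0,1)$ and all tie-breaking rules as above, if $\mathrm{OPT}\ge\alpha n$, then $$\text{NN-RDFS}\ \ge\ c\,\frac{n^{-1/2}}{\log^2 n}\,\mathrm{OPT}.$$ 2. There is an absolute constant $c>0$ such that for all $n\ge 2$, all $M$, all $\gamma\in(0,1)$ and all tie-breaking rules as above, $$\text{NN-RDFS}\ \ge\ c\,\frac{n^{-2/3}}{\log^2 n}\,\mathrm{OPT}.$$ -/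

import Mathlib

universe u v

/-- A deterministic MDP with `n` collectible rewards: `step` is the deterministic transition
function, and the `i`-th local reward is worth `1` in the state `rewardState i`, `0` in all other
states, and can be collected only once. The reward of the MDP is the sum of the local rewards. -/
structure CollectibleMDP (n : ℕ) where
  State : Type u
  Action : Type v
  step : State → Action → State
  start : State
  rewardState : Fin n → State

namespace CollectibleMDP

variable {n : ℕ}

/-- The state reached from `s` by a finite sequence of actions. -/
def run (M : CollectibleMDP.{u, v} n) (s : M.State) (l : List M.Action) : M.State :=
  l.foldl M.step s

/-- `t` can be reached from `s`. -/
def Reaches (M : CollectibleMDP.{u, v} n) (s t : M.State) : Prop :=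
  ∃ l : List M.Action, M.run s l = t

/-- The length (number of time steps) of a shortest path from `s` to `t`.
It is meaningful when `t` can be reached from `s`. -/
noncomputable def pathLength (M : CollectibleMDP.{u, v} n) (s t : M.State) : ℕ :=
  sInf {k : ℕ | ∃ l : List M.Action, l.length = k ∧ M.run s l = t}

/-- The states that are nodes of the associated graph: `none` stands for the initial state,
`some i` for the state of the `i`-th reward. -/
def nodeState (M : CollectibleMDP.{u, v} n) : Option (Fin n) → M.State
  | none => M.start
  | some i => M.rewardState i

/-- The length of the edge from the node `a` to the `j`-th reward: the time that the optimal
option for the `j`-th reward takes when it is started at `a`. -/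
noncomputable def edge (M : CollectibleMDP.{u, v} n) (a : Option (Fin n)) (j : Fin n) : ℕ :=
  M.pathLength (M.nodeState a) (M.rewardState j)

end CollectibleMDP

/-! The reward-discounted travelling salesman problem. `d a j` is the length of the edge from the
node `a` (`none` is the initial node) to the `j`-th reward. A walk is the list of the rewards it
visits, in chronological order and possibly with repetitions; it starts at the initial node, which
is not listed. -/
namespace RDTSP

variable {n : ℕ}

/-- The total length of the walk `l` when it is started at the node `a`. -/
def walkLength (d : Option (Fin n) → Fin n → ℕ) : Option (Fin n) → List (Fin n) → ℕ
  | _, [] => 0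
  | a, j :: l => d a j + walkLength d (some j) l

/-- The time at which the walk `w` visits the reward `j` for the first time
(used only for `j ∈ w`). -/
def arrival (d : Option (Fin n) → Fin n → ℕ) (w : List (Fin n)) (j : Fin n) : ℕ :=
  walkLength d none (w.take (w.idxOf j + 1))

/-- The discounted return of a walk: each reward counts once, at its first visit. -/
noncomputable def discountedReturn (γ : ℝ) (d : Option (Fin n) → Fin n → ℕ)
    (w : List (Fin n)) : ℝ :=
  ∑ j : Fin n, if j ∈ w then γ ^ arrival d w j else 0

/-- The optimal discounted return over all orders in which the rewards can be collected. -/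
noncomputable def opt (γ : ℝ) (d : Option (Fin n) → Fin n → ℕ) : ℝ :=
  Finset.univ.sup' Finset.univ_nonempty
    fun σ : Equiv.Perm (Fin n) => discountedReturn γ d (List.ofFn fun t => σ t)

/-- A reward of `U` that is nearest to the node `a`, or `none` if `U` is empty. Ties are broken by
`tie`, which may depend on the walk `h` made so far. -/
def nearest (d : Option (Fin n) → Fin n → ℕ) (tie : List (Fin n) → Finset (Fin n) → Fin n)
    (h : List (Fin n)) (a : Option (Fin n)) (U : Finset (Fin n)) : Option (Fin n) :=
  if U.Nonempty then some (tie h (U.filter fun j => ∀ k ∈ U, d a j ≤ d a k)) else none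

/-- Nearest neighbour: extend the walk `h`, from its current endpoint (`h.getLast?`, which is the
initial node if `h` is empty), by repeatedly going to the nearest reward not yet collected. The
first argument bounds the number of steps; `n` steps collect everything. -/
def nn (d : Option (Fin n) → Fin n → ℕ) (tie : List (Fin n) → Finset (Fin n) → Fin n) :
    ℕ → List (Fin n) → List (Fin n)
  | 0, h => h
  | k + 1, h =>
    match nearest d tie h h.getLast? (Finset.univ.filter fun j => j ∉ h) with
    | none => h
    | some j => nn d tie k (h ++ [j])

/-- Depth first search on the edges shorter than `θ`, nearest first. The second argument is the
stack (current reward on top), the third one the walk so far. At the reward `u`, go to the nearest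
reward not yet visited whose edge from `u` is shorter than `θ`, if there is one; otherwise walk back
to the reward from which `u` was discovered, and stop if `u` is the root. The first
argument bounds the number of steps; `2 * n` steps suffice, since every reward is entered and
left by at most one tree edge. -/
noncomputable def dfs (d : Option (Fin n) → Fin n → ℕ)
    (tie : List (Fin n) → Finset (Fin n) → Fin n) (θ : ℝ) :
    ℕ → List (Fin n) → List (Fin n) → List (Fin n)
  | 0, _, h => h
  | _ + 1, [], h => h
  | k + 1, u :: s, h =>
    match nearest d tie h (some u)
        (Finset.univ.filter fun j => j ∉ h ∧ (d (some u) j : ℝ) < θ) with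
    | some j => dfs d tie θ k (j :: u :: s) (h ++ [j])
    | none =>
      match s with
      | [] => h
      | p :: s' => dfs d tie θ k (p :: s') (h ++ [p])

/-- The walk of the nearest neighbour policy. -/
def nnWalk (d : Option (Fin n) → Fin n → ℕ) (tie : List (Fin n) → Finset (Fin n) → Fin n) :
    List (Fin n) :=
  nn d tie n []

/-- The walk of RDFS when the first reward is `s₁` and the threshold is `θ`: go to `s₁`, run depth
first search from there, and continue with nearest neighbour. -/
noncomputable def rdfsWalk (d : Option (Fin n) → Fin n → ℕ)
    (tie : List (Fin n) → Finset (Fin n) → Fin n) (θ : ℝ) (s₁ : Fin n) : List (Fin n) :=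
  nn d tie n (dfs d tie θ (2 * n) [s₁] [s₁])

/-- The threshold for the guess `n / 2 ^ i` of the number of rewards collected by the optimum:
`x / √(n / 2 ^ i)`, where `x = log_{1/γ} 2`. -/
noncomputable def threshold (n : ℕ) (γ : ℝ) (i : ℕ) : ℝ :=
  Real.logb (1 / γ) 2 / √((n : ℝ) / 2 ^ i)

/-- The expected return of NN-RDFS: with probability `1/2` run nearest neighbour; with probability
`1/2` run RDFS with `s₁` uniform among the `n` rewards and, independently, `i` uniform in
`{1, …, ⌊log₂ n⌋}`. -/
noncomputable def nnRDFS (γ : ℝ) (d : Option (Fin n) → Fin n → ℕ)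
    (tie : List (Fin n) → Finset (Fin n) → Fin n) : ℝ :=
  1 / 2 * discountedReturn γ d (nnWalk d tie) +
    1 / 2 * ((1 / (n : ℝ)) * ∑ s₁ : Fin n,
      (1 / (Nat.log 2 n : ℝ)) * ∑ i ∈ Finset.Icc 1 (Nat.log 2 n),
        discountedReturn γ d (rdfsWalk d tie (threshold n γ i) s₁))

end RDTSP

namespace CollectibleMDP

variable {n : ℕ}

/-- Every reward can be reached from the initial state and from every other reward, and travel
times between rewards are symmetric (the associated graph is undirected). -/
structure Undirected (M : CollectibleMDP.{u, v} n) : Prop where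
  reaches_start : ∀ i, M.Reaches M.start (M.rewardState i)
  reaches : ∀ i j, M.Reaches (M.rewardState i) (M.rewardState j)
  symm : ∀ i j, M.pathLength (M.rewardState i) (M.rewardState j) =
    M.pathLength (M.rewardState j) (M.rewardState i)

/-- The value of the optimal solution. -/
noncomputable def OPT (M : CollectibleMDP.{u, v} n) (γ : ℝ) : ℝ :=
  RDTSP.opt γ M.edge

/-- The expected return of NN-RDFS on `M`, with ties among nearest rewards broken by `tie`. -/
noncomputable def NNRDFS (M : CollectibleMDP.{u, v} n) (γ : ℝ)
    (tie : List (Fin n) → Finset (Fin n) → Fin n) : ℝ :=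
  RDTSP.nnRDFS γ M.edge tie

end CollectibleMDP

/-! ### Walks and first-visit times. -/

namespace RDTSP

variable {n : ℕ}

/-! Let `t j` be the arrival times of an optimal order and `x = log_{1/γ} 2` the halving time. By
the triangle inequality and symmetry, distinct rewards reached within `θ` of each other in time are
within distance `θ` (`exists_times`).

Suppose `k` rewards are reached in a window `[T, T + C * x]`. Some guess gives `θ ≈ x / √k`
(`exists_guess`), and cutting the window into `O(√k)` cells of length `θ` leaves about `√k` rewards
per cell on average. A search started at one of these rewards needs `O(√k)` moves, hence time
`O(x)`, to collect about `√k` rewards or its whole cell (`dfs_spec`). Averaging over starts and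
guesses gives a return of order `γ ^ T * k ^ (3/2) / (n log n)` (`le_nnRDFS`).

If the optimum is linear in `n`, a bounded number of halving times from time `0` contains linearly
many rewards, which gives the exponent `1/2`. In general let `T` be the distance to the nearest
reward: nearest neighbour earns at least `γ ^ T`. Split the time after `T` into slots of length `x`;
only `O(log n)` of them matter. In each slot the nearest neighbour bound (good for small `k`) is
traded against the search bound (good for large `k`); they balance at `n ^ (2/3)`. -/

theorem walkLength_append_cons (d : Option (Fin n) → Fin n → ℕ) (a : Option (Fin n))
    (l₁ : List (Fin n)) (j : Fin n) (l₂ : List (Fin n)) :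
    walkLength d a (l₁ ++ j :: l₂) =
      walkLength d a (l₁ ++ [j]) + walkLength d (some j) l₂ := by
  induction l₁ generalizing a with
  | nil => simp [walkLength]
  | cons b l ih => simp [walkLength, ih, add_assoc]

theorem walkLength_le_of_prefix (d : Option (Fin n) → Fin n → ℕ) (a : Option (Fin n))
    {l₁ l₂ : List (Fin n)} (h : l₁ <+: l₂) : walkLength d a l₁ ≤ walkLength d a l₂ := by
  induction l₁ generalizing a l₂ with
  | nil => simp [walkLength]
  | cons b l ih =>
    obtain ⟨e, rfl⟩ := h
    simpa [walkLength] using ih (some b) (List.prefix_append l e)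

theorem edge_le_walkLength {d : Option (Fin n) → Fin n → ℕ}
    (htri : ∀ a j k, d a k ≤ d a j + d (some j) k) (a : Option (Fin n))
    (l : List (Fin n)) (j : Fin n) : d a j ≤ walkLength d a (l ++ [j]) := by
  induction l generalizing a with
  | nil => simp [walkLength]
  | cons b l ih =>
    simpa [walkLength] using (htri a b j).trans (Nat.add_le_add_left (ih (some b)) _)

theorem arrival_append_cons (d : Option (Fin n) → Fin n → ℕ) {l₁ : List (Fin n)} {j : Fin n}
    (hj : j ∉ l₁) (l₂ : List (Fin n)) :
    arrival d (l₁ ++ j :: l₂) j = walkLength d none (l₁ ++ [j]) := by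
  have h : (l₁ ++ j :: l₂).idxOf j = l₁.length := by
    simp [List.idxOf_append_of_notMem hj]
  rw [arrival, h, List.take_length_add_append]
  simp

theorem arrival_le_of_prefix (d : Option (Fin n) → Fin n → ℕ) {p w : List (Fin n)}
    (h : p <+: w) {j : Fin n} (hj : j ∈ p) : arrival d w j ≤ walkLength d none p := by
  obtain ⟨e, rfl⟩ := h
  obtain ⟨l₁, l₂, rfl, hl⟩ := List.eq_append_cons_of_mem hj
  rw [List.append_assoc, List.cons_append, arrival_append_cons d hl]
  exact walkLength_le_of_prefix d none ⟨l₂, by simp⟩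

theorem edge_none_le_arrival {d : Option (Fin n) → Fin n → ℕ}
    (htri : ∀ a j k, d a k ≤ d a j + d (some j) k) {w : List (Fin n)} {j : Fin n}
    (hj : j ∈ w) : d none j ≤ arrival d w j := by
  obtain ⟨l₁, l₂, rfl, hl⟩ := List.eq_append_cons_of_mem hj
  rw [arrival_append_cons d hl]
  exact edge_le_walkLength htri none l₁ j

/-- Between the two first visits the walk travels from one reward to the other. Distinctness is
needed because nothing is assumed about the diagonal of `d`. -/
theorem edge_le_arrival_sub {d : Option (Fin n) → Fin n → ℕ}
    (htri : ∀ a j k, d a k ≤ d a j + d (some j) k)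
    (hsymm : ∀ i j, d (some i) j = d (some j) i) {w : List (Fin n)} {i j : Fin n}
    (hi : i ∈ w) (hj : j ∈ w) (hij : i ≠ j) :
    (d (some i) j : ℝ) ≤ |(arrival d w i : ℝ) - arrival d w j| := by
  have key : ∀ {i j : Fin n} (l₁ l₂ l₃ : List (Fin n)), i ∉ l₁ → j ∉ l₁ ++ i :: l₂ →
      w = l₁ ++ i :: (l₂ ++ j :: l₃) →
      arrival d w i + d (some i) j ≤ arrival d w j := by
    intro i j l₁ l₂ l₃ h₁ h₂ hw
    have e₁ : arrival d w i = walkLength d none (l₁ ++ [i]) := by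
      rw [hw, arrival_append_cons d h₁]
    have e₂ : arrival d w j = walkLength d none ((l₁ ++ i :: l₂) ++ [j]) := by
      rw [hw, ← arrival_append_cons d h₂ l₃]; simp
    rw [e₁, e₂, List.append_assoc, List.cons_append,
      walkLength_append_cons d none l₁ i (l₂ ++ [j])]
    exact Nat.add_le_add_left (edge_le_walkLength htri _ _ _) _
  obtain ⟨l₁, l₂, hw, hl⟩ := List.eq_append_cons_of_mem hi
  by_cases hjl : j ∈ l₁
  · obtain ⟨l₃, l₄, rfl, hl'⟩ := List.eq_append_cons_of_mem hjl
    have := key l₃ l₄ l₂ hl' hl (by simpa using hw)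
    have : (arrival d w j : ℝ) + d (some j) i ≤ arrival d w i := by exact_mod_cast this
    rw [hsymm i j]
    exact le_trans (by linarith) (le_abs_self _)
  · have hj₂ : j ∈ l₂ := by
      rw [hw] at hj
      simpa [hjl, hij.symm] using hj
    obtain ⟨l₃, l₄, rfl, hl'⟩ := List.eq_append_cons_of_mem hj₂
    have := key l₁ l₃ l₄ hl (by simp [hjl, hij.symm, hl']) hw
    have : (arrival d w i : ℝ) + d (some i) j ≤ arrival d w j := by exact_mod_cast this
    rw [abs_sub_comm]
    exact le_trans (by linarith) (le_abs_self _)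

/-! ### Nearest neighbour steps and depth first search. -/

theorem nearest_eq_some {d : Option (Fin n) → Fin n → ℕ}
    {tie : List (Fin n) → Finset (Fin n) → Fin n} (htie : ∀ h T, T.Nonempty → tie h T ∈ T)
    {h : List (Fin n)} {a : Option (Fin n)} {U : Finset (Fin n)} {j : Fin n}
    (hj : nearest d tie h a U = some j) : j ∈ U ∧ ∀ k ∈ U, d a j ≤ d a k := by
  unfold nearest at hj
  split_ifs at hj with hU
  obtain ⟨m, hm, hmin⟩ := U.exists_min_image (d a) hU
  have := htie h (U.filter fun j => ∀ k ∈ U, d a j ≤ d a k)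
    ⟨m, Finset.mem_filter.2 ⟨hm, hmin⟩⟩
  rw [Option.some.inj hj] at this
  exact Finset.mem_filter.1 this

theorem nearest_eq_none {d : Option (Fin n) → Fin n → ℕ}
    {tie : List (Fin n) → Finset (Fin n) → Fin n}
    {h : List (Fin n)} {a : Option (Fin n)} {U : Finset (Fin n)}
    (hj : nearest d tie h a U = none) : U = ∅ := by
  unfold nearest at hj
  split_ifs at hj with hU
  exact Finset.not_nonempty_iff_eq_empty.1 hU

theorem prefix_nn (d : Option (Fin n) → Fin n → ℕ)
    (tie : List (Fin n) → Finset (Fin n) → Fin n) (k : ℕ) (h : List (Fin n)) :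
    h <+: nn d tie k h := by
  induction k generalizing h with
  | zero => exact List.prefix_rfl
  | succ k ih =>
    unfold nn
    split
    · exact List.prefix_rfl
    · exact (List.prefix_append _ _).trans (ih _)

/-- Each move lengthens the walk by one and either pushes a new reward or pops one, so walk length
plus stack height stays twice the number of distinct rewards. The stack is never empty, whence the
count. The bounds are stated for all truncations `e.take r`, because only an initial piece of a long
search is cheap. Only the neighbours of the root are guaranteed at the end: the search cannot stop
at the root while one is missing. -/
theorem dfs_spec {d : Option (Fin n) → Fin n → ℕ}
    {tie : List (Fin n) → Finset (Fin n) → Fin n} (htie : ∀ h T, T.Nonempty → tie h T ∈ T)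
    (hsymm : ∀ i j, d (some i) j = d (some j) i) {θ : ℝ} (hθ : 0 ≤ θ) (s : Fin n) (k : ℕ)
    (u : Fin n) (st h : List (Fin n)) (hlast : (u :: st).getLast? = some s)
    (hlen : h.length + (u :: st).length = 2 * h.toFinset.card)
    (hchain : (u :: st).IsChain fun a b => (d (some a) b : ℝ) < θ)
    (hmem : ∀ v ∈ u :: st, v ∈ h) (hfuel : 2 * n ≤ k + h.length) :
    ∃ e, dfs d tie θ k (u :: st) h = h ++ e ∧
      (∀ r : ℕ, (walkLength d (some u) (e.take r) : ℝ) ≤ r * θ) ∧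
      (∀ r : ℕ, (h ++ e.take r).length + 1 ≤ 2 * (h ++ e.take r).toFinset.card) ∧
      ∀ j, (d (some s) j : ℝ) < θ → j ∈ h ++ e := by
  induction k generalizing u st h with
  | zero =>
    -- Without fuel the walk would have length at least `2 * n`, but the invariant with a nonempty
    -- stack allows at most `2 * n - 1`.
    have := Finset.card_le_univ h.toFinset
    simp only [Fintype.card_fin, List.length_cons] at this hlen
    omega
  | succ k ih =>
    have step : ∀ (v : Fin n) (st' : List (Fin n)), (v :: st').getLast? = some s →
        (h ++ [v]).length + (v :: st').length = 2 * (h ++ [v]).toFinset.card →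
        ((v :: st').IsChain fun a b => (d (some a) b : ℝ) < θ) →
        (∀ x ∈ v :: st', x ∈ h ++ [v]) → (d (some u) v : ℝ) < θ →
        ∃ e, dfs d tie θ k (v :: st') (h ++ [v]) = h ++ e ∧
          (∀ r : ℕ, (walkLength d (some u) (e.take r) : ℝ) ≤ r * θ) ∧
          (∀ r : ℕ, (h ++ e.take r).length + 1 ≤ 2 * (h ++ e.take r).toFinset.card) ∧
          ∀ j, (d (some s) j : ℝ) < θ → j ∈ h ++ e := by
      intro v st' h₁ h₂ h₃ h₄ h₅
      obtain ⟨e, he, hw, hc, hn⟩ := ih v st' (h ++ [v]) h₁ h₂ h₃ h₄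
        (by simp only [List.length_append, List.length_singleton]; omega)
      refine ⟨v :: e, by simpa using he, ?_, ?_, by simpa using hn⟩
      · rintro (_ | r)
        · simp [walkLength]
        · have := hw r
          simp only [List.take_succ_cons, walkLength]
          push_cast
          linarith
      · rintro (_ | r)
        · simp only [List.length_cons] at hlen
          simp only [List.take_zero, List.append_nil]
          omega
        · simpa using hc r
    unfold dfs
    split
    · next j hj =>
      obtain ⟨hjU, -⟩ := nearest_eq_some htie hj
      simp only [Finset.mem_filter, Finset.mem_univ, true_and] at hjU
      refine step j (u :: st) (by simpa using hlast) ?_ ?_ ?_ hjU.2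
      · have : (h ++ [j]).toFinset = insert j h.toFinset := by ext; simp
        rw [this, Finset.card_insert_of_notMem (by simpa using hjU.1)]
        simp only [List.length_append, List.length_cons, List.length_nil] at hlen ⊢
        omega
      -- The chain runs from the top of the stack to the root, the direction of walking back;
      -- symmetry reverses the discovery edge.
      · exact List.IsChain.cons_cons (by rw [hsymm]; exact hjU.2) hchain
      · intro x hx
        rcases List.mem_cons.1 hx with rfl | hx
        · simp
        · simp [hmem x hx]
    · next hnone =>
      have hU := nearest_eq_none hnone
      cases st with
      | nil =>
        have hus : u = s := by simpa using hlast
        subst hus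
        refine ⟨[], by simp, by intro r; simpa [walkLength] using by positivity, ?_, ?_⟩
        · intro r
          simp only [List.length_cons, List.length_nil] at hlen
          simp only [List.take_nil, List.append_nil]
          omega
        · intro j hj
          by_contra hjh
          have : j ∈ (∅ : Finset (Fin n)) := by
            rw [← hU]
            simpa using ⟨by simpa using hjh, hj⟩
          simp at this
      | cons p st =>
        have hp : p ∈ h := hmem p (by simp)
        refine step p st (by simpa using hlast) ?_ hchain.tail ?_ (List.isChain_cons_cons.1 hchain).1
        · have : (h ++ [p]).toFinset = h.toFinset := by
            ext x
            simp only [List.mem_toFinset, List.mem_append, List.mem_singleton]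
            exact ⟨fun hx => hx.elim id fun hx => hx ▸ hp, Or.inl⟩
          rw [this]
          simp only [List.length_append, List.length_cons, List.length_nil] at hlen ⊢
          omega
        · intro x hx
          exact List.mem_append_left _ (hmem x (List.mem_cons_of_mem _ hx))

/-! ### Lower bounds for the return of a single walk. -/

theorem discountedReturn_nonneg {γ : ℝ} (hγ : 0 < γ) (d : Option (Fin n) → Fin n → ℕ)
    (w : List (Fin n)) : 0 ≤ discountedReturn γ d w :=
  Finset.sum_nonneg fun j _ => by split_ifs <;> positivity

theorem card_mul_le_discountedReturn {γ : ℝ} (hγ : 0 < γ) (hγ₁ : γ < 1)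
    (d : Option (Fin n) → Fin n → ℕ) {p w : List (Fin n)} (hp : p <+: w) {D : ℝ}
    (hD : (walkLength d none p : ℝ) ≤ D) :
    (p.toFinset.card : ℝ) * γ ^ D ≤ discountedReturn γ d w := by
  calc (p.toFinset.card : ℝ) * γ ^ D
      = ∑ j ∈ p.toFinset, γ ^ D := by simp
    _ ≤ ∑ j ∈ p.toFinset, if j ∈ w then γ ^ arrival d w j else 0 := by
        refine Finset.sum_le_sum fun j hj => ?_
        have hj : j ∈ p := by simpa using hj
        rw [if_pos (hp.subset hj), ← Real.rpow_natCast]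
        refine Real.rpow_le_rpow_of_exponent_ge hγ hγ₁.le (le_trans ?_ hD)
        exact_mod_cast arrival_le_of_prefix d hp hj
    _ ≤ discountedReturn γ d w :=
        Finset.sum_le_sum_of_subset_of_nonneg (Finset.subset_univ _)
          fun j _ _ => by split_ifs <;> positivity

theorem pow_le_discountedReturn_nnWalk {γ : ℝ} (hγ : 0 < γ) (hγ₁ : γ < 1)
    {d : Option (Fin n) → Fin n → ℕ} {tie : List (Fin n) → Finset (Fin n) → Fin n}
    (htie : ∀ h T, T.Nonempty → tie h T ∈ T) (i : Fin n) :
    γ ^ d none i ≤ discountedReturn γ d (nnWalk d tie) := by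
  obtain ⟨m, rfl⟩ : ∃ m, n = m + 1 := ⟨n - 1, by have := i.pos; omega⟩
  unfold nnWalk nn
  split
  · next h => exact absurd (nearest_eq_none h) (Finset.ne_empty_of_mem (a := i) (by simp))
  · next j h =>
    have hle : d none j ≤ d none i := (nearest_eq_some htie h).2 i (by simp)
    have := card_mul_le_discountedReturn hγ hγ₁ d (prefix_nn d tie m ([] ++ [j]))
      (D := d none i) (by simpa [walkLength] using hle)
    simpa using this

/-- Starting at `s₁`, depth first search collects within `2 * m` steps either `m` rewards or all
rewards that are closer than `θ` to `s₁`. -/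
theorem min_mul_le_discountedReturn_rdfsWalk {γ : ℝ} (hγ : 0 < γ) (hγ₁ : γ < 1)
    {d : Option (Fin n) → Fin n → ℕ} {tie : List (Fin n) → Finset (Fin n) → Fin n}
    (htie : ∀ h T, T.Nonempty → tie h T ∈ T)
    (hsymm : ∀ i j, d (some i) j = d (some j) i) {θ : ℝ} (hθ : 0 ≤ θ) (s₁ : Fin n) (m : ℕ)
    (B : Finset (Fin n)) (hB : ∀ j ∈ B, j ≠ s₁ → (d (some s₁) j : ℝ) < θ) {D : ℝ}
    (hD : d none s₁ + 2 * m * θ ≤ D) :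
    (min m B.card : ℕ) * γ ^ D ≤ discountedReturn γ d (rdfsWalk d tie θ s₁) := by
  have hpos := s₁.pos
  obtain ⟨e, he, hw, hc, hn⟩ := dfs_spec htie hsymm hθ s₁ (2 * n) s₁ [] [s₁] (by simp) (by simp)
    (by simp) (by simp) (by omega)
  have hpre : [s₁] ++ e.take (2 * m) <+: rdfsWalk d tie θ s₁ := by
    refine List.IsPrefix.trans ?_ (prefix_nn d tie n _)
    rw [he]
    exact (List.prefix_append_right_inj _).2 (List.take_prefix _ _)
  have hlen : (walkLength d none ([s₁] ++ e.take (2 * m)) : ℝ) ≤ D := by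
    have := hw (2 * m)
    simp only [List.singleton_append, walkLength]
    push_cast at this ⊢
    linarith
  refine le_trans ?_ (card_mul_le_discountedReturn hγ hγ₁ d hpre hlen)
  refine mul_le_mul_of_nonneg_right ?_ (Real.rpow_nonneg hγ.le _)
  norm_cast
  -- Either the search is long enough for the counting bound to apply, or it has ended and contains
  -- every neighbour of the root.
  by_cases hm : 2 * m ≤ e.length
  · have := hc (2 * m)
    simp only [List.length_append, List.length_take, List.length_singleton, min_eq_left hm] at this
    omega
  · refine (min_le_right _ _).trans (Finset.card_le_card fun j hj => ?_)
    rw [List.take_of_length_le (by omega), List.mem_toFinset]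
    by_cases hjs : j = s₁
    · simp [hjs]
    · exact hn j (hB j hj hjs)

end RDTSP

/-! ### The triangle inequality for shortest paths. -/

namespace CollectibleMDP

variable {n : ℕ}

theorem Reaches.exists_run {M : CollectibleMDP.{u, v} n} {s t : M.State} (h : M.Reaches s t) :
    ∃ l : List M.Action, l.length = M.pathLength s t ∧ M.run s l = t := by
  obtain ⟨l, hl⟩ := h
  exact Nat.sInf_mem (s := {k : ℕ | ∃ l : List M.Action, l.length = k ∧ M.run s l = t})
    ⟨_, l, rfl, hl⟩

theorem pathLength_le_add {M : CollectibleMDP.{u, v} n} {r s t : M.State}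
    (h₁ : M.Reaches r s) (h₂ : M.Reaches s t) :
    M.pathLength r t ≤ M.pathLength r s + M.pathLength s t := by
  obtain ⟨l₁, e₁, r₁⟩ := h₁.exists_run
  obtain ⟨l₂, e₂, r₂⟩ := h₂.exists_run
  refine Nat.sInf_le ⟨l₁ ++ l₂, by simp [e₁, e₂], ?_⟩
  simp only [run] at r₁ r₂ ⊢
  rw [List.foldl_append, r₁, r₂]

theorem Undirected.edge_le_add {M : CollectibleMDP.{u, v} n} (hM : M.Undirected)
    (a : Option (Fin n)) (j k : Fin n) : M.edge a k ≤ M.edge a j + M.edge (some j) k := by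
  refine pathLength_le_add ?_ (hM.reaches j k)
  cases a with
  | none => exact hM.reaches_start j
  | some i => exact hM.reaches i j

end CollectibleMDP

/-! ### Expected return from one time window. -/

namespace RDTSP

variable {n : ℕ}

/-- A fibre of size `c` contributes `c * min m c ≥ 2 * μ * c - μ ^ 2`: by `(c - μ) ^ 2 ≥ 0` if `c ≤
m`, and by `m ≥ 2 * μ` otherwise. This replaces Cauchy–Schwarz in a form that tolerates the cap `m`.
-/
theorem two_mul_sub_le_sum_min_card {ι : Type*} (S : Finset ι) (f : ι → ℕ) {K : ℕ}
    (hf : ∀ s ∈ S, f s < K) {μ : ℝ} {m : ℕ} (hm : 2 * μ ≤ m) :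
    2 * μ * S.card - μ ^ 2 * K ≤
      ∑ s ∈ S, ((min m (S.filter fun j => f j = f s).card : ℕ) : ℝ) := by
  have hmaps : ∀ s ∈ S, f s ∈ Finset.range K := fun s hs => Finset.mem_range.2 (hf s hs)
  rw [← Finset.sum_fiberwise_of_maps_to hmaps, Finset.card_eq_sum_card_fiberwise hmaps]
  have hK : μ ^ 2 * (K : ℝ) = ∑ _b ∈ Finset.range K, μ ^ 2 := by simp [mul_comm]
  rw [hK, Nat.cast_sum, Finset.mul_sum, ← Finset.sum_sub_distrib]
  refine Finset.sum_le_sum fun b _ => ?_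
  set c := (S.filter fun j => f j = b).card with hc
  have : ∑ s ∈ S with f s = b, ((min m (S.filter fun j => f j = f s).card : ℕ) : ℝ) =
      c * ((min m c : ℕ) : ℝ) := by
    rw [Finset.sum_congr rfl (g := fun _ => ((min m c : ℕ) : ℝ))]
    · simp [hc]
    · intro s hs
      rw [(Finset.mem_filter.1 hs).2]
  rw [this]
  have hc0 : (0 : ℝ) ≤ c := Nat.cast_nonneg c
  rcases le_total m c with h | h
  · rw [min_eq_left h]
    nlinarith [mul_le_mul_of_nonneg_left hm hc0, sq_nonneg μ]
  · rw [min_eq_right h]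
    nlinarith [sq_nonneg ((c : ℝ) - μ)]

/-- Taking `i = Nat.log 2 (n / k)` gives `k ≤ n / 2 ^ i < 2 * k`. The guess `0` is excluded, so `i =
1` serves when `n < 2 * k`, which costs the factor `1/2` on the left. -/
theorem exists_guess {k : ℕ} (hn : 2 ≤ n) (hk : 0 < k) (hkn : k ≤ n) :
    ∃ i ∈ Finset.Icc 1 (Nat.log 2 n),
      (k : ℝ) / 2 ≤ (n : ℝ) / 2 ^ i ∧ (n : ℝ) / 2 ^ i ≤ 2 * k := by
  have hdiv : n / k ≠ 0 := (Nat.div_pos hkn hk).ne'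
  have h₁ : 2 ^ Nat.log 2 (n / k) * k ≤ n :=
    (Nat.le_div_iff_mul_le hk).1 (Nat.pow_log_le_self 2 hdiv)
  have h₂ : n < 2 ^ (Nat.log 2 (n / k) + 1) * k :=
    (Nat.div_lt_iff_lt_mul hk).1 (Nat.lt_pow_succ_log_self (by norm_num) _)
  have h₁' : (2 : ℝ) ^ Nat.log 2 (n / k) * k ≤ n := by exact_mod_cast h₁
  have h₂' : (n : ℝ) < 2 ^ (Nat.log 2 (n / k) + 1) * k := by exact_mod_cast h₂
  have hlog : 1 ≤ Nat.log 2 n := Nat.log_pos (by norm_num) hn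
  rcases Nat.eq_zero_or_pos (Nat.log 2 (n / k)) with h0 | hpos
  · rw [h0] at h₁' h₂'
    rw [zero_add, pow_one] at h₂'
    rw [pow_zero, one_mul] at h₁'
    refine ⟨1, Finset.mem_Icc.2 ⟨le_rfl, hlog⟩, ?_, ?_⟩ <;> rw [pow_one] <;> linarith
  · refine ⟨Nat.log 2 (n / k), Finset.mem_Icc.2
      ⟨hpos, Nat.log_mono_right (Nat.div_le_self n k)⟩, ?_, ?_⟩
    · rw [le_div_iff₀ (by positivity)]
      nlinarith
    · rw [div_le_iff₀ (by positivity)]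
      rw [pow_succ] at h₂'
      linarith

theorem logb_inv_pos {γ : ℝ} (hγ : 0 < γ) (hγ₁ : γ < 1) : 0 < Real.logb (1 / γ) 2 :=
  Real.logb_pos (by rw [lt_div_iff₀ hγ]; linarith) (by norm_num)

theorem rpow_mul_logb_inv {γ : ℝ} (hγ : 0 < γ) (hγ₁ : γ < 1) (y : ℝ) :
    γ ^ (y * Real.logb (1 / γ) 2) = (1 / 2 : ℝ) ^ y := by
  have h : (1 / γ) ^ Real.logb (1 / γ) 2 = 2 :=
    Real.rpow_logb (by positivity) (ne_of_gt (by rw [lt_div_iff₀ hγ]; linarith)) (by norm_num)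
  rw [one_div γ, Real.inv_rpow hγ.le, inv_eq_iff_eq_inv] at h
  rw [mul_comm, Real.rpow_mul hγ.le, one_div γ, h, one_div]

/-- If `S` consists of rewards that some walk visits during a time interval of length
`C * log_{1/γ} 2` that begins at time `T`, then a first reward in `S` and a guess close to the
size of `S` give a large expected return. -/
theorem le_nnRDFS {γ : ℝ} (hn : 2 ≤ n) (hγ : 0 < γ) (hγ₁ : γ < 1)
    {d : Option (Fin n) → Fin n → ℕ} {tie : List (Fin n) → Finset (Fin n) → Fin n}
    (htie : ∀ h T, T.Nonempty → tie h T ∈ T)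
    (hsymm : ∀ i j, d (some i) j = d (some j) i) {S : Finset (Fin n)} (hS : S.Nonempty)
    {t : Fin n → ℕ} (ht : ∀ j, d none j ≤ t j)
    (hdt : ∀ i j, i ≠ j → (d (some i) j : ℝ) ≤ |(t i : ℝ) - t j|) {T C : ℝ} (hC : 0 ≤ C)
    (hlow : ∀ j ∈ S, T ≤ t j) (hup : ∀ j ∈ S, t j ≤ T + C * Real.logb (1 / γ) 2) :
    (1 / 2 : ℝ) ^ (C + 6) / (4 * (2 * C + 1)) *
      (γ ^ T * (S.card * √S.card) / (n * Nat.log 2 n)) ≤ nnRDFS γ d tie := by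
  have hkn : S.card ≤ n := by simpa using S.card_le_univ
  have hk : 0 < S.card := hS.card_pos
  obtain ⟨i, hi, hq₁, hq₂⟩ := exists_guess hn hk hkn
  set k := S.card with hkdef
  set x := Real.logb (1 / γ) 2 with hx
  set q := (n : ℝ) / 2 ^ i with hq
  set θ := threshold n γ i with hθ
  have hxpos : 0 < x := logb_inv_pos hγ hγ₁
  have hk1 : (1 : ℝ) ≤ k := by exact_mod_cast hk
  have hqpos : 0 < q := by linarith
  have hsq : 0 < √q := Real.sqrt_pos.2 hqpos
  have hθx : θ * √q = x := div_mul_cancel₀ x hsq.ne'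
  have hθpos : 0 < θ := div_pos hxpos hsq
  have hsk : 1 ≤ √(k : ℝ) := Real.one_le_sqrt.2 hk1
  have hsksq : √(k : ℝ) ^ 2 = k := Real.sq_sqrt (by linarith)
  have hqk : √q ≤ 2 * √(k : ℝ) := Real.sqrt_le_iff.2 ⟨by linarith, by nlinarith⟩
  -- Following the search for `2 * m` moves takes time at most `6 * x`, so discounting costs only a
  -- constant factor.
  set m := ⌈√(k : ℝ)⌉₊ with hm
  have hm₁ : √(k : ℝ) ≤ m := Nat.le_ceil _
  have hm₂ : (m : ℝ) ≤ 2 * √(k : ℝ) := by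
    have := Nat.ceil_lt_add_one (Real.sqrt_nonneg (k : ℝ))
    linarith
  have hmθ : 2 * m * θ ≤ 6 * x := by
    have : 2 * (m : ℝ) ≤ 6 * √q := by
      have h : √(k : ℝ) ≤ 3 / 2 * √q :=
        Real.sqrt_le_iff.2 ⟨by positivity, by rw [mul_pow, Real.sq_sqrt hqpos.le]; linarith⟩
      linarith
    calc 2 * m * θ ≤ 6 * √q * θ := mul_le_mul_of_nonneg_right this hθpos.le
      _ = 6 * x := by rw [← hθx]; ring
  set A := 2 * C + 1 with hA
  have hApos : 1 ≤ A := by linarith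
  -- The cell of length `θ` containing the arrival time; rewards of `S` in one cell are
  -- `θ`-neighbours.
  set f : Fin n → ℕ := fun j => ⌊(t j - T) / θ⌋₊ with hf
  set K := ⌊2 * C * √(k : ℝ)⌋₊ + 1 with hK
  have hKle : (K : ℝ) ≤ A * √(k : ℝ) := by
    have := Nat.floor_le (a := 2 * C * √(k : ℝ)) (by positivity)
    rw [hK]
    push_cast
    rw [hA]
    linarith
  have hfK : ∀ s ∈ S, f s < K := by
    intro s hs
    refine Nat.lt_succ_of_le (Nat.floor_le_floor ?_)
    rw [div_le_iff₀ hθpos]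
    have h₁ := hup s hs
    have h₂ : C * x ≤ C * (2 * √(k : ℝ)) * θ := by
      rw [← hθx, mul_assoc, mul_comm (2 * √(k : ℝ))]
      exact mul_le_mul_of_nonneg_left (mul_le_mul_of_nonneg_left hqk hθpos.le) hC
    linarith
  have hclose : ∀ s ∈ S, ∀ j ∈ S, f j = f s → j ≠ s → (d (some s) j : ℝ) < θ := by
    intro s hs j hj hjs hne
    refine (hdt s j hne.symm).trans_lt ?_
    have hs₁ := Nat.floor_le (div_nonneg (sub_nonneg.2 (hlow s hs)) hθpos.le)
    have hs₂ := Nat.lt_floor_add_one ((t s - T) / θ)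
    have hj₁ := Nat.floor_le (div_nonneg (sub_nonneg.2 (hlow j hj)) hθpos.le)
    have hj₂ := Nat.lt_floor_add_one ((t j - T) / θ)
    have hfl : ⌊(t j - T) / θ⌋₊ = ⌊(t s - T) / θ⌋₊ := hjs
    rw [hfl] at hj₁ hj₂
    rw [le_div_iff₀ hθpos] at hs₁ hj₁
    rw [div_lt_iff₀ hθpos] at hs₂ hj₂
    rw [abs_lt]
    constructor <;> linarith
  set D := T + (C + 6) * x with hD
  have hγD : γ ^ D = γ ^ T * (1 / 2 : ℝ) ^ (C + 6) := by
    rw [hD, Real.rpow_add hγ, hx, rpow_mul_logb_inv hγ hγ₁]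
  have hrdfs : ∀ s ∈ S, ((min m (S.filter fun j => f j = f s).card : ℕ) : ℝ) * γ ^ D ≤
      discountedReturn γ d (rdfsWalk d tie θ s) := by
    intro s hs
    refine min_mul_le_discountedReturn_rdfsWalk hγ hγ₁ htie hsymm hθpos.le s m _ ?_ ?_
    · intro j hj hne
      obtain ⟨hjS, hjf⟩ := Finset.mem_filter.1 hj
      exact hclose s hs j hjS hjf hne
    · have h₁ : (d none s : ℝ) ≤ t s := by exact_mod_cast ht s
      have h₂ := hup s hs
      rw [hD]
      linarith
  have hsum : k * √(k : ℝ) / (2 * A) ≤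
      ∑ s ∈ S, ((min m (S.filter fun j => f j = f s).card : ℕ) : ℝ) := by
    -- With `K ≤ A * √k` this `μ` makes the subtracted term at most a quarter of the main term.
    refine le_trans ?_ (two_mul_sub_le_sum_min_card S f hfK (μ := √(k : ℝ) / (2 * A)) (m := m)
      ?_)
    · have h : (√(k : ℝ) / (2 * A)) ^ 2 * K ≤ (√(k : ℝ) / (2 * A)) ^ 2 * (A * √(k : ℝ)) :=
        mul_le_mul_of_nonneg_left hKle (sq_nonneg _)
      have e : (√(k : ℝ) / (2 * A)) ^ 2 * (A * √(k : ℝ)) = k * √(k : ℝ) / (4 * A) := by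
        rw [div_pow, hsksq]
        field_simp
        norm_num
      have e₂ : 2 * (√(k : ℝ) / (2 * A)) * k = 4 * (k * √(k : ℝ) / (4 * A)) := by
        field_simp
      have e₃ : k * √(k : ℝ) / (2 * A) = 2 * (k * √(k : ℝ) / (4 * A)) := by
        field_simp
        norm_num
      have h₀ : 0 ≤ k * √(k : ℝ) / (4 * A) := by positivity
      rw [← hkdef]
      linarith
    · refine le_trans ?_ hm₁
      rw [← mul_div_assoc, mul_div_mul_left _ _ (two_ne_zero' ℝ)]
      exact div_le_self (Real.sqrt_nonneg _) hApos
  have hnpos : (0 : ℝ) < n := by exact_mod_cast (by omega : 0 < n)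
  have hLpos : (0 : ℝ) < Nat.log 2 n := by exact_mod_cast Nat.log_pos (by norm_num) hn
  have hinner : ∀ s : Fin n, 1 / (Nat.log 2 n : ℝ) * discountedReturn γ d (rdfsWalk d tie θ s) ≤
      1 / (Nat.log 2 n : ℝ) * ∑ i ∈ Finset.Icc 1 (Nat.log 2 n),
        discountedReturn γ d (rdfsWalk d tie (threshold n γ i) s) := fun s =>
    mul_le_mul_of_nonneg_left
      (Finset.single_le_sum
        (f := fun i => discountedReturn γ d (rdfsWalk d tie (threshold n γ i) s))
        (fun _ _ => discountedReturn_nonneg hγ _ _) hi) (by positivity)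
  have houter : 1 / (Nat.log 2 n : ℝ) * (k * √(k : ℝ) / (2 * A) * γ ^ D) ≤
      ∑ s : Fin n, 1 / (Nat.log 2 n : ℝ) * ∑ i ∈ Finset.Icc 1 (Nat.log 2 n),
        discountedReturn γ d (rdfsWalk d tie (threshold n γ i) s) := by
    calc 1 / (Nat.log 2 n : ℝ) * (k * √(k : ℝ) / (2 * A) * γ ^ D)
        ≤ 1 / (Nat.log 2 n : ℝ) * ∑ s ∈ S, discountedReturn γ d (rdfsWalk d tie θ s) := by
          refine mul_le_mul_of_nonneg_left ?_ (by positivity)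
          refine (mul_le_mul_of_nonneg_right hsum (Real.rpow_nonneg hγ.le _)).trans ?_
          rw [Finset.sum_mul]
          exact Finset.sum_le_sum hrdfs
      _ ≤ 1 / (Nat.log 2 n : ℝ) * ∑ s : Fin n, discountedReturn γ d (rdfsWalk d tie θ s) := by
          refine mul_le_mul_of_nonneg_left ?_ (by positivity)
          exact Finset.sum_le_sum_of_subset_of_nonneg (Finset.subset_univ _)
            fun _ _ _ => discountedReturn_nonneg hγ _ _
      _ ≤ _ := by
          rw [Finset.mul_sum]
          exact Finset.sum_le_sum fun s _ => hinner s
  calc (1 / 2 : ℝ) ^ (C + 6) / (4 * A) * (γ ^ T * (k * √(k : ℝ)) / (n * Nat.log 2 n))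
      = 1 / 2 * (1 / (n : ℝ) *
          (1 / (Nat.log 2 n : ℝ) * (k * √(k : ℝ) / (2 * A) * γ ^ D))) := by
        rw [hγD]
        field_simp
        norm_num
    _ ≤ 1 / 2 * (1 / (n : ℝ) * ∑ s : Fin n, 1 / (Nat.log 2 n : ℝ) *
          ∑ i ∈ Finset.Icc 1 (Nat.log 2 n),
            discountedReturn γ d (rdfsWalk d tie (threshold n γ i) s)) := by
        gcongr
    _ ≤ nnRDFS γ d tie :=
        le_add_of_nonneg_left (mul_nonneg (by norm_num) (discountedReturn_nonneg hγ _ _))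

theorem half_pow_le_nnRDFS {γ : ℝ} (hγ : 0 < γ) (hγ₁ : γ < 1)
    {d : Option (Fin n) → Fin n → ℕ} {tie : List (Fin n) → Finset (Fin n) → Fin n}
    (htie : ∀ h T, T.Nonempty → tie h T ∈ T) (i : Fin n) :
    1 / 2 * γ ^ d none i ≤ nnRDFS γ d tie := by
  refine (mul_le_mul_of_nonneg_left
    (pow_le_discountedReturn_nnWalk hγ hγ₁ htie i) (by norm_num)).trans
    (le_add_of_nonneg_right ?_)
  refine mul_nonneg (by norm_num) (mul_nonneg (by positivity) (Finset.sum_nonneg fun _ _ =>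
    mul_nonneg (by positivity) (Finset.sum_nonneg fun _ _ => discountedReturn_nonneg hγ _ _)))

/-- The arrival times of an optimal order of the rewards. -/
theorem exists_times (γ : ℝ) {d : Option (Fin n) → Fin n → ℕ}
    (htri : ∀ a j k, d a k ≤ d a j + d (some j) k)
    (hsymm : ∀ i j, d (some i) j = d (some j) i) :
    ∃ t : Fin n → ℕ, opt γ d = ∑ j, γ ^ t j ∧ (∀ j, d none j ≤ t j) ∧
      ∀ i j, i ≠ j → (d (some i) j : ℝ) ≤ |(t i : ℝ) - t j| := by
  obtain ⟨σ, -, hσ⟩ := Finset.exists_mem_eq_sup' (Finset.univ_nonempty (α := Equiv.Perm (Fin n)))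
    fun σ : Equiv.Perm (Fin n) => discountedReturn γ d (List.ofFn fun t => σ t)
  have hmem : ∀ j, j ∈ List.ofFn fun t => σ t := fun j =>
    List.mem_ofFn.2 ⟨σ.symm j, σ.apply_symm_apply j⟩
  refine ⟨arrival d (List.ofFn fun t => σ t), ?_, fun j => edge_none_le_arrival htri (hmem j),
    fun i j hij => edge_le_arrival_sub htri hsymm (hmem i) (hmem j) hij⟩
  rw [opt, hσ, discountedReturn]
  exact Finset.sum_congr rfl fun j _ => if_pos (hmem j)

theorem natLog_le_two_mul_log (n : ℕ) : (Nat.log 2 n : ℝ) ≤ 2 * Real.log n := by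
  rcases Nat.eq_zero_or_pos n with rfl | hpos
  · simp
  · have h : ((2 : ℝ) ^ Nat.log 2 n) ≤ n := by exact_mod_cast Nat.pow_log_le_self 2 hpos.ne'
    have := Real.log_le_log (by positivity) h
    rw [Real.log_pow] at this
    have := Real.log_two_gt_d9
    nlinarith [Nat.cast_nonneg (α := ℝ) (Nat.log 2 n)]

end RDTSP

/-! ### The two competitive ratios. -/

namespace RDTSP

variable {n : ℕ}

theorem natLog_le_four_mul_sq_log (hn : 2 ≤ n) :
    (1 : ℝ) ≤ Nat.log 2 n ∧ (Nat.log 2 n : ℝ) ^ 2 ≤ 4 * Real.log n ^ 2 := by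
  have h₁ : (1 : ℝ) ≤ Nat.log 2 n := by exact_mod_cast Nat.log_pos (by norm_num) hn
  have h₂ := natLog_le_two_mul_log n
  exact ⟨h₁, by nlinarith⟩

theorem opt_mul_le_nnRDFS_of_linear {α : ℝ} (hα : 0 < α) :
    ∃ c : ℝ, 0 < c ∧ ∀ (n : ℕ), 2 ≤ n → ∀ (γ : ℝ), 0 < γ → γ < 1 →
      ∀ (d : Option (Fin n) → Fin n → ℕ), (∀ a j k, d a k ≤ d a j + d (some j) k) →
      (∀ i j, d (some i) j = d (some j) i) →
      ∀ (tie : List (Fin n) → Finset (Fin n) → Fin n), (∀ h T, T.Nonempty → tie h T ∈ T) →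
      α * n ≤ opt γ d →
      c * ((n : ℝ) ^ (-(1 / 2) : ℝ) / Real.log n ^ 2) * opt γ d ≤ nnRDFS γ d tie := by
  -- After `C` halving times a reward is worth at most `α / 2`, so late rewards supply at most half
  -- of `α * n`. The absolute value keeps `C` nonnegative when `α > 2`.
  set C := |Real.logb 2 (2 / α)| with hCdef
  have hC : 0 ≤ C := abs_nonneg _
  have hCα : (1 / 2 : ℝ) ^ C ≤ α / 2 := by
    calc (1 / 2 : ℝ) ^ C ≤ (1 / 2 : ℝ) ^ Real.logb 2 (2 / α) :=
          Real.rpow_le_rpow_of_exponent_ge (by norm_num) (by norm_num) (le_abs_self _)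
      _ = α / 2 := by
          rw [one_div, Real.inv_rpow (by norm_num),
            Real.rpow_logb (by norm_num) (by norm_num) (by positivity), inv_div]
  set a := (1 / 2 : ℝ) ^ (C + 6) / (4 * (2 * C + 1)) with ha
  have hapos : 0 < a := by positivity
  refine ⟨a * (α / 2 * √(α / 2)) / 4, by positivity, ?_⟩
  intro n hn γ hγ hγ₁ d htri hsymm tie htie hopt
  obtain ⟨t, hot, ht, hdt⟩ := exists_times γ htri hsymm
  obtain ⟨hL₁, hL₂⟩ := natLog_le_four_mul_sq_log hn
  have hnpos : (0 : ℝ) < n := by exact_mod_cast (by omega : 0 < n)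
  set x := Real.logb (1 / γ) 2 with hx
  set S : Finset (Fin n) := Finset.univ.filter fun j => (t j : ℝ) ≤ 0 + C * x with hS
  have hle : opt γ d ≤ S.card + n * (α / 2) := by
    have : ∀ j : Fin n, γ ^ t j ≤ (if (t j : ℝ) ≤ 0 + C * x then 1 else 0) + α / 2 := by
      intro j
      split_ifs with hj
      · have := pow_le_one₀ hγ.le hγ₁.le (n := t j)
        linarith
      · rw [zero_add, not_le] at hj
        rw [zero_add, ← Real.rpow_natCast]
        refine (Real.rpow_le_rpow_of_exponent_ge hγ hγ₁.le hj.le).trans ?_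
        rwa [rpow_mul_logb_inv hγ hγ₁]
    rw [hot]
    refine (Finset.sum_le_sum fun j _ => this j).trans_eq ?_
    rw [Finset.sum_add_distrib, Finset.sum_boole]
    simp [hS]
  have hk : n * (α / 2) ≤ S.card := by linarith
  have hne : S.Nonempty := by
    rw [← Finset.card_pos, ← Nat.cast_pos (α := ℝ)]
    exact lt_of_lt_of_le (by positivity) hk
  have hmain := le_nnRDFS hn hγ hγ₁ htie hsymm hne ht hdt (T := 0) hC (fun j _ => Nat.cast_nonneg _)
    (fun j hj => (Finset.mem_filter.1 hj).2)
  rw [← ha, Real.rpow_zero, one_mul] at hmain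
  refine le_trans ?_ hmain
  have hoptn : opt γ d ≤ n := by
    rw [hot]
    refine (Finset.sum_le_sum fun j _ => pow_le_one₀ hγ.le hγ₁.le (n := t j)).trans_eq (by simp)
  have hrpow : (n : ℝ) ^ (-(1 / 2) : ℝ) = √n / n := by
    rw [Real.sqrt_eq_rpow, eq_div_iff hnpos.ne', ← Real.rpow_add_one hnpos.ne']
    norm_num
  have hlog : 0 < Real.log n ^ 2 := by nlinarith
  have hkk : n * (α / 2) * (√n * √(α / 2)) ≤ S.card * √S.card := by
    rw [← Real.sqrt_mul hnpos.le]
    exact mul_le_mul hk (Real.sqrt_le_sqrt hk) (Real.sqrt_nonneg _) (Nat.cast_nonneg _)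
  calc a * (α / 2 * √(α / 2)) / 4 * ((n : ℝ) ^ (-(1 / 2) : ℝ) / Real.log n ^ 2) * opt γ d
      ≤ a * (α / 2 * √(α / 2)) / 4 * ((n : ℝ) ^ (-(1 / 2) : ℝ) / Real.log n ^ 2) * n :=
        mul_le_mul_of_nonneg_left hoptn (by positivity)
    _ = a * (n * (α / 2) * (√n * √(α / 2)) / (n * (4 * Real.log n ^ 2))) := by
        rw [hrpow]
        field_simp
    _ ≤ a * (S.card * √S.card / (n * Nat.log 2 n)) := by
        refine mul_le_mul_of_nonneg_left ?_ hapos.le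
        refine div_le_div₀ (by positivity) hkk (by positivity) ?_
        -- Only one logarithm is lost here; `Nat.log 2 n ≤ (Nat.log 2 n) ^ 2` weakens it to the
        -- stated square.
        exact mul_le_mul_of_nonneg_left (by nlinarith) hnpos.le

/-- Trading the bound `2 * k * R`, which is good for small `k`, against a bound that is good for
large `k`. -/
theorem le_of_le_mul_of_mul_sqrt_le {V R k N L a : ℝ} (hV : 0 ≤ V) (hk : 0 < k) (hN : 0 < N)
    (hL : 1 ≤ L) (ha : 0 < a) (ha₁ : a ≤ 1) (hR : 0 ≤ R) (h₁ : V ≤ 2 * k * R)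
    (h₂ : a * (V * √k) ≤ R * (N * L)) : V ≤ 2 / a * R * N ^ (2 / 3 : ℝ) * L := by
  have hN3 : (N ^ (2 / 3 : ℝ)) ^ 3 = N ^ 2 := by
    rw [← Real.rpow_natCast, ← Real.rpow_mul hN.le]
    norm_num
  have h₃ : a ^ 2 * V ^ 2 * k ≤ (R * (N * L)) ^ 2 := by
    calc a ^ 2 * V ^ 2 * k = (a * (V * √k)) ^ 2 := by
          rw [mul_pow, mul_pow, Real.sq_sqrt hk.le, mul_assoc]
      _ ≤ _ := pow_le_pow_left₀ (by positivity) h₂ 2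
  -- Multiplying the first bound by the square of the second cancels `k`; the cube root then yields
  -- `N ^ (2 / 3)`.
  have h₄ : (a * V) ^ 3 ≤ 2 * R * (R * (N * L)) ^ 2 := by
    have h₅ : a ^ 3 * V ^ 3 * k ≤ 2 * R * (R * (N * L)) ^ 2 * k :=
      calc a ^ 3 * V ^ 3 * k = a * V * (a ^ 2 * V ^ 2 * k) := by ring
        _ ≤ 1 * (2 * k * R) * (R * (N * L)) ^ 2 := by gcongr
        _ = _ := by ring
    rw [mul_pow]
    exact le_of_mul_le_mul_right h₅ hk
  have h₆ : a * V ≤ 2 * R * N ^ (2 / 3 : ℝ) * L := by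
    refine le_of_pow_le_pow_left₀ (n := 3) (by norm_num) (by positivity) (h₄.trans ?_)
    have e : (2 * R * N ^ (2 / 3 : ℝ) * L) ^ 3 = 8 * R ^ 3 * N ^ 2 * L ^ 3 := by
      rw [mul_pow, mul_pow, mul_pow, hN3]
      norm_num
    have h₇ : 2 * L ^ 2 ≤ 8 * L ^ 3 := by nlinarith [sq_nonneg L]
    calc 2 * R * (R * (N * L)) ^ 2 = R ^ 3 * N ^ 2 * (2 * L ^ 2) := by ring
      _ ≤ R ^ 3 * N ^ 2 * (8 * L ^ 3) := by gcongr
      _ = _ := by rw [e]; ring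
  calc V = a * V / a := by field_simp
    _ ≤ 2 * R * N ^ (2 / 3 : ℝ) * L / a := by gcongr
    _ = _ := by ring

/-- One logarithm comes from the random guess of the threshold, the other from the number of slots.
-/
theorem opt_mul_le_nnRDFS :
    ∃ c : ℝ, 0 < c ∧ ∀ (n : ℕ), 2 ≤ n → ∀ (γ : ℝ), 0 < γ → γ < 1 →
      ∀ (d : Option (Fin n) → Fin n → ℕ), (∀ a j k, d a k ≤ d a j + d (some j) k) →
      (∀ i j, d (some i) j = d (some j) i) →
      ∀ (tie : List (Fin n) → Finset (Fin n) → Fin n), (∀ h T, T.Nonempty → tie h T ∈ T) →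
      c * ((n : ℝ) ^ (-(2 / 3) : ℝ) / Real.log n ^ 2) * opt γ d ≤ nnRDFS γ d tie := by
  set a := (1 / 2 : ℝ) ^ ((1 : ℝ) + 6) / (4 * (2 * 1 + 1)) with ha
  have hapos : 0 < a := by positivity
  have ha₁ : a ≤ 1 := by
    have : (1 / 2 : ℝ) ^ ((1 : ℝ) + 6) ≤ 1 :=
      Real.rpow_le_one (by norm_num) (by norm_num) (by norm_num)
    rw [ha, div_le_one (by norm_num)]
    linarith
  refine ⟨a / 24, by positivity, ?_⟩
  intro n hn γ hγ hγ₁ d htri hsymm tie htie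
  obtain ⟨t, hot, ht, hdt⟩ := exists_times γ htri hsymm
  obtain ⟨hL₁, hL₂⟩ := natLog_le_four_mul_sq_log hn
  have hnpos : (0 : ℝ) < n := by exact_mod_cast (by omega : 0 < n)
  set x := Real.logb (1 / γ) 2 with hx
  have hxpos : 0 < x := logb_inv_pos hγ hγ₁
  set L := Nat.log 2 n with hL
  set R := nnRDFS γ d tie with hR
  obtain ⟨i, -, hi⟩ := (Finset.univ : Finset (Fin n)).exists_min_image (d none)
    ⟨⟨0, by omega⟩, Finset.mem_univ _⟩
  set T : ℝ := ((d none i : ℕ) : ℝ) with hT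
  have htT : ∀ j, T ≤ t j := fun j => by
    exact Nat.cast_le.2 ((hi j (Finset.mem_univ _)).trans (ht j))
  have hg : γ ^ T ≤ 2 * R := by
    have := half_pow_le_nnRDFS (d := d) hγ hγ₁ htie i
    rw [hT, Real.rpow_natCast]
    linarith
  have hgpos : 0 < γ ^ T := Real.rpow_pos_of_pos hγ _
  have hRpos : 0 ≤ R := by linarith
  set f : Fin n → ℕ := fun j => ⌊(t j - T) / x⌋₊ with hf
  have hf₁ : ∀ j, T + f j * x ≤ t j := fun j => by
    have := Nat.floor_le (div_nonneg (sub_nonneg.2 (htT j)) hxpos.le)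
    rw [le_div_iff₀ hxpos] at this
    simp only [hf]
    linarith
  have hf₂ : ∀ j, t j ≤ T + f j * x + 1 * x := fun j => by
    have := Nat.lt_floor_add_one ((t j - T) / x)
    rw [div_lt_iff₀ hxpos] at this
    simp only [hf]
    linarith
  -- Since `2 ^ (L + 1) > n`, all the later slots together are worth at most `γ ^ T`, which nearest
  -- neighbour pays for.
  have hfar : ∀ j, L + 1 ≤ f j → γ ^ t j ≤ γ ^ T / n := by
    intro j hj
    have hj' : ((L + 1 : ℕ) : ℝ) * x ≤ f j * x :=
      mul_le_mul_of_nonneg_right (Nat.cast_le.2 hj) hxpos.le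
    calc γ ^ t j = γ ^ (t j : ℝ) := (Real.rpow_natCast _ _).symm
      _ ≤ γ ^ (T + ((L + 1 : ℕ) : ℝ) * x) :=
          Real.rpow_le_rpow_of_exponent_ge hγ hγ₁.le (by linarith [hf₁ j])
      _ = γ ^ T / 2 ^ (L + 1) := by
          rw [Real.rpow_add hγ, rpow_mul_logb_inv hγ hγ₁, Real.rpow_natCast (1 / 2), one_div, inv_pow,
            div_eq_mul_inv]
      _ ≤ γ ^ T / n := by
          refine div_le_div_of_nonneg_left hgpos.le hnpos ?_
          exact_mod_cast (Nat.lt_pow_succ_log_self (by norm_num) n).le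
  set B := 2 / a * R * (n : ℝ) ^ (2 / 3 : ℝ) * L with hB
  have hBpos : 0 ≤ B := by positivity
  have hslot : ∀ l : ℕ, ∑ j with f j = l, γ ^ t j ≤ B := by
    intro l
    set S : Finset (Fin n) := Finset.univ.filter fun j => f j = l with hS
    have hsum : ∑ j ∈ S, γ ^ t j ≤ S.card * γ ^ (T + l * x) := by
      rw [← nsmul_eq_mul]
      refine Finset.sum_le_card_nsmul _ _ _ fun j hj => ?_
      rw [← Real.rpow_natCast, ← (Finset.mem_filter.1 hj).2]
      exact Real.rpow_le_rpow_of_exponent_ge hγ hγ₁.le (hf₁ j)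
    refine hsum.trans ?_
    rcases S.eq_empty_or_nonempty with hS0 | hne
    · simpa [hS0] using hBpos
    · have hmain := le_nnRDFS hn hγ hγ₁ htie hsymm hne ht hdt (T := T + l * x) zero_le_one
        (fun j hj => by rw [← (Finset.mem_filter.1 hj).2]; exact hf₁ j)
        (fun j hj => by rw [← (Finset.mem_filter.1 hj).2]; exact hf₂ j)
      rw [← ha, ← mul_div_assoc, div_le_iff₀ (by positivity)] at hmain
      refine le_of_le_mul_of_mul_sqrt_le (by positivity) (Nat.cast_pos.2 hne.card_pos) hnpos hL₁
        hapos ha₁ hRpos ?_ ?_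
      · have : γ ^ (T + l * x) ≤ γ ^ T :=
          Real.rpow_le_rpow_of_exponent_ge hγ hγ₁.le (le_add_of_nonneg_right (by positivity))
        calc S.card * γ ^ (T + l * x) ≤ S.card * (2 * R) :=
              mul_le_mul_of_nonneg_left (this.trans hg) (Nat.cast_nonneg _)
          _ = _ := by ring
      · refine le_trans (le_of_eq ?_) hmain
        ring
  have hopt : opt γ d ≤ 2 * R + (L + 1) * B := by
    rw [hot, ← Finset.sum_filter_add_sum_filter_not Finset.univ (fun j => f j ∈ Finset.range (L + 1)),
      add_comm]
    refine add_le_add ?_ ?_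
    · calc ∑ j with ¬ f j ∈ Finset.range (L + 1), γ ^ t j
          ≤ ∑ j with ¬ f j ∈ Finset.range (L + 1), γ ^ T / n :=
            Finset.sum_le_sum fun j hj => hfar j (by simpa using hj)
        _ ≤ ∑ _j : Fin n, γ ^ T / n :=
            Finset.sum_le_sum_of_subset_of_nonneg (Finset.filter_subset _ _)
              fun _ _ _ => by positivity
        _ = γ ^ T := by
            rw [Finset.sum_const, Finset.card_univ, Fintype.card_fin, nsmul_eq_mul]
            field_simp
        _ ≤ 2 * R := hg
    · rw [← Finset.sum_fiberwise_of_maps_to (t := Finset.range (L + 1)) (g := f)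
        fun j hj => (Finset.mem_filter.1 hj).2]
      calc _ ≤ ∑ _l ∈ Finset.range (L + 1), B := by
            refine Finset.sum_le_sum fun l _ => le_trans ?_ (hslot l)
            exact Finset.sum_le_sum_of_subset_of_nonneg
              (Finset.filter_subset_filter _ (Finset.filter_subset _ _))
              fun _ _ _ => by positivity
        _ = (L + 1) * B := by simp
  have hn23 : 1 ≤ (n : ℝ) ^ (2 / 3 : ℝ) :=
    Real.one_le_rpow (by exact_mod_cast (by omega : 1 ≤ n)) (by norm_num)
  -- The tail contributes `2` and the slots `4`; replacing `L ^ 2` by `4 * Real.log n ^ 2` gives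
  -- `24`.
  have hopt' : a * opt γ d ≤ 24 * (R * (n : ℝ) ^ (2 / 3 : ℝ) * Real.log n ^ 2) := by
    have haB : a * B = 2 * (R * (n : ℝ) ^ (2 / 3 : ℝ) * L) := by
      rw [hB]
      field_simp
    have h₁ : a * (2 * R) ≤ 2 * (R * (n : ℝ) ^ (2 / 3 : ℝ) * (L : ℝ) ^ 2) :=
      calc a * (2 * R) ≤ 1 * (2 * R) := by gcongr
        _ = 2 * (R * 1 * 1 ^ 2) := by ring
        _ ≤ _ := by gcongr
    have h₂ : (L + 1) * (R * (n : ℝ) ^ (2 / 3 : ℝ) * L) ≤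
        2 * (R * (n : ℝ) ^ (2 / 3 : ℝ) * (L : ℝ) ^ 2) :=
      calc (L + 1) * (R * (n : ℝ) ^ (2 / 3 : ℝ) * L)
          ≤ (L + L) * (R * (n : ℝ) ^ (2 / 3 : ℝ) * L) := by gcongr
        _ = _ := by ring
    have h₃ : R * (n : ℝ) ^ (2 / 3 : ℝ) * (L : ℝ) ^ 2 ≤
        R * (n : ℝ) ^ (2 / 3 : ℝ) * (4 * Real.log n ^ 2) := by gcongr
    calc a * opt γ d ≤ a * (2 * R + (L + 1) * B) := by gcongr
      _ = a * (2 * R) + (L + 1) * (a * B) := by ring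
      _ = a * (2 * R) + 2 * ((L + 1) * (R * (n : ℝ) ^ (2 / 3 : ℝ) * L)) := by rw [haB]; ring
      _ ≤ _ := by linarith
  have hlog : 0 < Real.log n ^ 2 := by nlinarith
  calc a / 24 * ((n : ℝ) ^ (-(2 / 3) : ℝ) / Real.log n ^ 2) * opt γ d
      = a * opt γ d / (24 * ((n : ℝ) ^ (2 / 3 : ℝ) * Real.log n ^ 2)) := by
        rw [Real.rpow_neg hnpos.le]
        field_simp
    _ ≤ R := by
        rw [div_le_iff₀ (by positivity)]
        linarith

end RDTSP

theorem mainTheorem1 :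
    (∀ α : ℝ, 0 < α → ∃ c : ℝ, 0 < c ∧
      ∀ (n : ℕ), 2 ≤ n → ∀ (M : CollectibleMDP.{u, v} n), M.Undirected →
      ∀ (γ : ℝ), 0 < γ → γ < 1 →
      ∀ (tie : List (Fin n) → Finset (Fin n) → Fin n),
        (∀ h T, T.Nonempty → tie h T ∈ T) →
        α * n ≤ M.OPT γ →
        c * ((n : ℝ) ^ (-(1 / 2) : ℝ) / Real.log n ^ 2) * M.OPT γ ≤ M.NNRDFS γ tie) ∧
    (∃ c : ℝ, 0 < c ∧
      ∀ (n : ℕ), 2 ≤ n → ∀ (M : CollectibleMDP.{u, v} n), M.Undirected →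
      ∀ (γ : ℝ), 0 < γ → γ < 1 →
      ∀ (tie : List (Fin n) → Finset (Fin n) → Fin n),
        (∀ h T, T.Nonempty → tie h T ∈ T) →
        c * ((n : ℝ) ^ (-(2 / 3) : ℝ) / Real.log n ^ 2) * M.OPT γ ≤ M.NNRDFS γ tie) := by
  refine ⟨fun α hα => ?_, ?_⟩
  · obtain ⟨c, hc, h⟩ := RDTSP.opt_mul_le_nnRDFS_of_linear hα
    exact ⟨c, hc, fun n hn M hM γ hγ hγ₁ tie htie hopt =>
      h n hn γ hγ hγ₁ M.edge hM.edge_le_add hM.symm tie htie hopt⟩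
  · obtain ⟨c, hc, h⟩ := RDTSP.opt_mul_le_nnRDFS
    exact ⟨c, hc, fun n hn M hM γ hγ hγ₁ tie htie =>
      h n hn γ hγ hγ₁ M.edge hM.edge_le_add hM.symm tie htie⟩
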